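/- Let $G$ be an infinite countable cancellative semigroup (a unit is not required). A sequence $\mathcal F=(F_n)_{n\in\mathbb N}$ of finite subsets of $G$ is a \emph{Følner sequence} if for every nonempty finite $K\subset G$ and every $\varepsilon>0$, for all but finitely many $n$ the set $F_n$ is nonempty and $|KF_n\triangle F_n|\le\varepsilon|F_n|$. Assume that $G$ is amenable, i.e. that it has a Følner sequence. Suppose that $G$ acts on a standard probability space $(X,\mu)$ by measure-preserving maps. For a finite measurable partition $\mathcal P$ of $X$ put $h(\mu,\mathcal P)=\lim_n\frac1{|F_n|}H(\mu,\mathcal P^{F_n})$, where $\mathcal P^{F}=\bigvee_{g\in F}g^{-1}\mathcal P$, $H$ is the Shannon entropy (base $2$) and $(F_n)$ is a Følner sequence; the limit exists and does not depend on the choice of $(F_n)$. The Kolmogorov--Sinai entropy is $h(\mu)=\sup_{\mathcal P}h(\mu,\mathcal P)$. A dynamical system $(X,G)$ is an action of $G$ by continuous maps on a compact metric space $X$ (a unit of $G$, if any, acting as the identity); its topological entropy is $\sup_\mu h(\mu)$ over all $G$-invariant Borel probability measures $\mu$ on $X$. A function $f:G\to\mathbb R$ is \emph{strongly deterministic} if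 there are a dynamical system $(X,G)$ of topological entropy zero, a continuous $\varphi:X\to\mathbb R$ and a point $x\in X$ with $f(g)=\varphi(g(x))$ for all $g\in G$. Let $\mathcal F=(F_n)$ be a Følner sequence in $G$. For compact $I\subset\mathbb R$, let $G$ act on $I^G$ by the shift $g(x)(h)=x(hg)$. A function $f:G\to\mathbb R$ is \emph{$\mathcal F$-deterministic} if it takes values in some compact $I\subset\mathbb R$ such that $h(\mu)=0$ for every shift-invariant Borel probability measure $\mu$ on $I^G$ that is a weak* accumulation point of the averages $\frac1{|F_n|}\sum_{g\in F_n}\delta_{g(f)}$. \textbf{Theorem.} \begin{enumerate} \item For every Følner sequence $\mathcal F$ in $G$: if $f_n:G\to\mathbb R$ ($n\ge1$) are $\mathcal F$-deterministic and $f_n\to f_0$ uniformly on $G$, then $f_0$ is $\mathcal F$-deterministic. \item The strongly deterministic functions form a (unital) subalgebra of the algebra of all functions $G\to\mathbb R$, with pointwise operations, and this subalgebra is closed under uniform limits of sequences. \end{enumerate} -/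

import Mathlib

open MeasureTheory Filter Topology
open scoped Pointwise NNReal ENNReal symmDiff

noncomputable section

namespace Determinism

universe u v

section Folner

variable {G : Type u} [Semigroup G]

open Classical in
/-- A finite set `F` is `(K, ε)`-invariant: it is nonempty and `|KF ∆ F| / |F| ≤ ε`. -/
def IsInvariantSet (K : Finset G) (ε : ℝ) (F : Finset G) : Prop :=
  F.Nonempty ∧ (((K * F) ∆ F).card : ℝ) / (F.card : ℝ) ≤ ε

/-- Følner sequences: for every nonempty finite `K` and every `ε > 0`, all but finitely many of
the finite sets `F n` are `(K, ε)`-invariant. -/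
def IsFolner (F : ℕ → Finset G) : Prop :=
  ∀ K : Finset G, K.Nonempty → ∀ ε : ℝ, 0 < ε → ∀ᶠ n in atTop, IsInvariantSet K ε (F n)

variable (G) in
/-- A semigroup is amenable if it has a Følner sequence. -/
def IsAmenable : Prop := ∃ F : ℕ → Finset G, IsFolner F

end Folner

section Measures

variable {G : Type u} {X : Type v} [MeasurableSpace X]

/-- `μ` is invariant under all the maps `T g`. -/
def IsInvariantMeasure (T : G → X → X) (μ : ProbabilityMeasure X) : Prop :=
  ∀ g : G, (μ : Measure X).map (T g) = (μ : Measure X)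

/-- The point mass at `x`. -/
def pointMass (x : X) : FiniteMeasure X := ⟨Measure.dirac x, inferInstance⟩

/-- The average `|F|⁻¹ ∑_{g ∈ F} δ_{g(x)}` of point masses along the piece of orbit given by `F`. -/
def orbitAverage (T : G → X → X) (x : X) (F : Finset G) : FiniteMeasure X :=
  (F.card : ℝ≥0)⁻¹ • ∑ g ∈ F, pointMass (T g x)

/-- `x` is quasi-generic for `μ` along the sequence `F`: the measure `μ` is an accumulation point,
in the weak-* topology, of the sequence of averages along the sets `F n`. -/
def IsQuasiGeneric [TopologicalSpace X] [OpensMeasurableSpace X] (F : ℕ → Finset G)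
    (T : G → X → X) (x : X) (μ : ProbabilityMeasure X) : Prop :=
  MapClusterPt μ.toFiniteMeasure atTop (fun n => orbitAverage T x (F n))

/-- Shannon entropy (to base `2`) of the partition of `X` into the fibres of `P : X → ι`. -/
def shannonEntropy (μ : ProbabilityMeasure X) {ι : Type*} [Fintype ι] (P : X → ι) : ℝ :=
  ∑ i : ι, Real.negMulLog ((μ : Measure X).real (P ⁻¹' {i})) / Real.log 2

/-- The partition `P^F = ⋁_{g ∈ F} g⁻¹(P)`: its cells are the fibres of `x ↦ (P(g(x)))_{g ∈ F}`. -/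
def refinement (T : G → X → X) {ι : Type*} (P : X → ι) (F : Finset G) : X → (F → ι) :=
  fun x g => P (T g.1 x)

open Classical in
/-- The dynamical entropy `h(μ, P) = lim_n |F_n|⁻¹ H(μ, P^{F_n})`, where `(F_n)` is a Følner
sequence. For an invariant measure the limit exists and is the same for all Følner sequences;
taking the supremum over all of them of the upper limits is a way to write this common value
without choosing a particular sequence. -/
def partitionEntropy [Semigroup G] (T : G → X → X) (μ : ProbabilityMeasure X)
    {ι : Type*} [Fintype ι] (P : X → ι) : ℝ≥0∞ :=
  ⨆ (F : ℕ → Finset G) (_ : IsFolner F),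
    limsup (fun n => ENNReal.ofReal (shannonEntropy μ (refinement T P (F n)) / ((F n).card : ℝ))) atTop

/-- The Kolmogorov-Sinai entropy `h(μ)`: the supremum of `h(μ, P)` over all finite measurable
partitions `P`, a partition being given by the measurable map that labels its cells. -/
def ksEntropy [Semigroup G] (T : G → X → X) (μ : ProbabilityMeasure X) : ℝ≥0∞ :=
  ⨆ (k : ℕ) (P : X → Fin k) (_ : Measurable P), partitionEntropy T μ P

/-- Topological entropy: the supremum of `h(μ)` over all invariant probability measures `μ`. -/
def topEntropy [Semigroup G] (T : G → X → X) : ℝ≥0∞ :=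
  ⨆ (μ : ProbabilityMeasure X) (_ : IsInvariantMeasure T μ), ksEntropy T μ

end Measures

section Deterministic

variable {G : Type u} [Semigroup G]

/-- Dynamical systems `(X, G)`: a compact metric space `X` with its Borel sets, on which the
semigroup `G` acts by continuous maps. A unit of `G`, if there is one, acts as the identity. -/
structure System (G : Type u) [Semigroup G] where
  X : Type
  [metric : MetricSpace X]
  [compact : CompactSpace X]
  [meas : MeasurableSpace X]
  [borel : BorelSpace X]
  act : G → X → X
  act_continuous : ∀ g, Continuous (act g)
  act_mul : ∀ g h x, act (g * h) x = act g (act h x)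
  act_unit : ∀ e : G, (∀ g, e * g = g ∧ g * e = g) → ∀ x, act e x = x

attribute [instance] System.metric System.compact System.meas System.borel

/-- `f` is strongly deterministic: `f(g) = φ(g(x))` for some system of topological entropy zero,
some continuous real function `φ` and some point `x`. -/
def StronglyDeterministic (f : G → ℝ) : Prop :=
  ∃ (S : System G) (φ : S.X → ℝ) (x : S.X),
    topEntropy S.act = 0 ∧ Continuous φ ∧ ∀ g, f g = φ (S.act g x)

/-- The shift action of `G` on `I^G`: `g(x)(h) = x(hg)`. -/
def shift {I : Type*} (g : G) (x : G → I) : G → I := fun h => x (h * g)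

/-- A function `f : G → I` is deterministic with respect to `F`: the Kolmogorov-Sinai entropy
is zero for every shift-invariant measure on `I^G` for which `f` is quasi-generic along `F`. -/
def IsDeterministicIn [Countable G] (F : ℕ → Finset G) (I : Set ℝ) (f : G → I) : Prop :=
  ∀ μ : ProbabilityMeasure (G → I),
    IsInvariantMeasure shift μ → IsQuasiGeneric F shift f μ →
      ksEntropy (shift : G → (G → I) → (G → I)) μ = 0

/-- A real function on `G` is `F`-deterministic if it takes its values in a compact set `I`,
and is deterministic with respect to `F` as an element of `I^G`. -/
def FDeterministic [Countable G] (F : ℕ → Finset G) (f : G → ℝ) : Prop :=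
  ∃ (I : Set ℝ) (_ : IsCompact I) (hf : ∀ g, f g ∈ I),
    IsDeterministicIn F I (fun g => ⟨f g, hf g⟩)

end Deterministic

end Determinism

end

namespace Determinism

/-! Both parts rest on the Pinsker σ-algebra of an invariant measure: the measurable sets `A` whose
partition `{A, Aᶜ}` has zero dynamical entropy. That it is a σ-algebra follows from three facts:
entropy decreases under coarsening, is subadditive under joins, and satisfies `h(μ, P) ≤ H(μ, P)`.
All three hold for a supremum of upper limits, so the existence of the limit is never needed. The
Pinsker algebra contains the pullback of every zero-entropy factor (`comap_le_pinskerAlgebra`) and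
is closed under a.e. equality. Hence whatever is measurable, up to null sets, with respect to
countably many zero-entropy factors has zero entropy.

For strong determinism, a countable product of zero-entropy systems has zero topological entropy, so
a continuous function of a sequence of strongly deterministic functions is again strongly
deterministic. Sums and products are of this form, and so are uniform limits, by Tietze extension.

For `F`-determinism, a measure `μ` for which `f₀` is quasi-generic lifts to a joining `ν` generated
by the joint orbit of `f₀` and all `f n`. The marginals of `ν` over the `f n` have zero entropy by
assumption, and uniform convergence makes the coordinate over `f₀` a.e. the limit of the others. So
that coordinate is Pinsker measurable, and its law `μ` has zero entropy. -/

theorem ennreal_limsup_add_le {α : Type*} (f : Filter α) (u v : α → ℝ≥0∞) :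
    limsup (fun a => u a + v a) f ≤ limsup u f + limsup v f := by
  by_cases hu : limsup u f = ∞
  · simp [hu]
  by_cases hv : limsup v f = ∞
  · simp [hv]
  refine ENNReal.le_of_forall_pos_le_add fun ε hε _ => ?_
  have hε2 : (ε / 2 : ℝ≥0∞) ≠ 0 := by simpa using hε.ne'
  have h1 := eventually_lt_of_limsup_lt (ENNReal.lt_add_right hu hε2)
  have h2 := eventually_lt_of_limsup_lt (ENNReal.lt_add_right hv hε2)
  refine limsup_le_of_le (h := ?_)
  filter_upwards [h1, h2] with a ha hb
  refine (add_le_add ha.le hb.le).trans_eq ?_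
  rw [add_add_add_comm, ENNReal.add_halves]

/-! ### Shannon entropy of finite partitions: monotonicity and subadditivity. -/

section Shannon

variable {Z : Type*} [MeasurableSpace Z] (μ : ProbabilityMeasure Z)

open Classical in
theorem sum_real_fibre {κ : Type*} [Fintype κ] {Q : Z → κ}
    (hQ : ∀ k, MeasurableSet (Q ⁻¹' {k})) (s : Set κ) :
    (μ : Measure Z).real (Q ⁻¹' s) =
      ∑ k with k ∈ s, (μ : Measure Z).real (Q ⁻¹' {k}) := by
  rw [← measureReal_biUnion_finset]
  · congr 1
    ext z
    simp
  · intro i _ j _ hij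
    exact Disjoint.preimage _ (by simpa using hij)
  · exact fun k _ => hQ k

theorem negMulLog_sum_le {κ : Type*} (s : Finset κ) (p : κ → ℝ) (hp : ∀ k, 0 ≤ p k) :
    Real.negMulLog (∑ k ∈ s, p k) ≤ ∑ k ∈ s, Real.negMulLog (p k) := by
  unfold Real.negMulLog
  rw [← Finset.sum_neg_distrib, Finset.sum_mul]
  refine Finset.sum_le_sum fun k hk => ?_
  rcases (hp k).eq_or_lt with h0 | h0
  · simp [← h0]
  · have h1 : p k ≤ ∑ k ∈ s, p k := Finset.single_le_sum (fun i _ => hp i) hk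
    have := mul_le_mul_of_nonneg_left (Real.log_le_log h0 h1) h0.le
    linarith

/-- Each cell of `P` is a union of cells of `Q`, and `negMulLog` is subadditive on nonnegative
reals. Measurability is asked of fibres, so the label types need no σ-algebra. -/
theorem shannonEntropy_comp_le {κ ι : Type*} [Fintype κ] [Fintype ι] {Q : Z → κ}
    (hQ : ∀ k, MeasurableSet (Q ⁻¹' {k})) {P : Z → ι} (φ : κ → ι) (hP : ∀ z, P z = φ (Q z)) :
    shannonEntropy μ P ≤ shannonEntropy μ Q := by
  classical
  unfold shannonEntropy
  rw [← Finset.sum_div, ← Finset.sum_div]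
  refine div_le_div_of_nonneg_right ?_ (Real.log_nonneg (by norm_num))
  rw [← Finset.sum_fiberwise Finset.univ φ (fun k => Real.negMulLog _)]
  refine Finset.sum_le_sum fun i _ => ?_
  have : P ⁻¹' {i} = Q ⁻¹' (φ ⁻¹' {i}) := by
    ext z
    simp [hP]
  rw [this, sum_real_fibre μ hQ]
  exact negMulLog_sum_le _ _ fun k => measureReal_nonneg

/-- Termwise form of the Gibbs inequality. -/
theorem negMulLog_le_gibbs {r p q : ℝ} (hr : 0 ≤ r) (hrp : r ≤ p) (hrq : r ≤ q) :
    Real.negMulLog r ≤ -r * Real.log p + -r * Real.log q + (p * q - r) := by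
  rcases hr.eq_or_lt with h0 | h0
  · subst h0
    simpa using mul_nonneg hrp hrq
  · have hp := h0.trans_le hrp
    have hq := h0.trans_le hrq
    have h := Real.log_le_sub_one_of_pos (x := p * q / r) (by positivity)
    rw [Real.log_div (by positivity) h0.ne', Real.log_mul hp.ne' hq.ne'] at h
    have h2 := mul_le_mul_of_nonneg_left h hr
    have h3 : r * (p * q / r - 1) = p * q - r := by field_simp
    unfold Real.negMulLog
    nlinarith

theorem measurableSet_fibre_prodMk {κ ι : Type*} {P : Z → ι} {Q : Z → κ}
    (hP : ∀ k, MeasurableSet (P ⁻¹' {k})) (hQ : ∀ k, MeasurableSet (Q ⁻¹' {k})) (k : ι × κ) :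
    MeasurableSet ((fun z => (P z, Q z)) ⁻¹' {k}) := by
  have : (fun z => (P z, Q z)) ⁻¹' {k} = P ⁻¹' {k.1} ∩ Q ⁻¹' {k.2} := by
    ext z
    simp [Prod.ext_iff]
  rw [this]
  exact (hP _).inter (hQ _)

theorem measurableSet_fibre_pi {κ ι : Type*} [Countable κ] {P : κ → Z → ι}
    (hP : ∀ k i, MeasurableSet (P k ⁻¹' {i})) (a : κ → ι) :
    MeasurableSet ((fun z k => P k z) ⁻¹' {a}) := by
  have : (fun z k => P k z) ⁻¹' {a} = ⋂ k, P k ⁻¹' {a k} := by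
    ext z
    simp [funext_iff]
  rw [this]
  exact MeasurableSet.iInter fun k => hP _ _

theorem sum_real_fibre_univ {κ : Type*} [Fintype κ] {Q : Z → κ}
    (hQ : ∀ k, MeasurableSet (Q ⁻¹' {k})) : ∑ k, (μ : Measure Z).real (Q ⁻¹' {k}) = 1 := by
  simpa using (sum_real_fibre μ hQ Set.univ).symm

theorem shannonEntropy_prodMk_le {κ ι : Type*} [Fintype κ] [Fintype ι] {P : Z → ι} {Q : Z → κ}
    (hP : ∀ k, MeasurableSet (P ⁻¹' {k})) (hQ : ∀ k, MeasurableSet (Q ⁻¹' {k})) :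
    shannonEntropy μ (fun z => (P z, Q z)) ≤ shannonEntropy μ P + shannonEntropy μ Q := by
  classical
  have hPQ := measurableSet_fibre_prodMk hP hQ
  unfold shannonEntropy
  rw [← Finset.sum_div, ← Finset.sum_div, ← Finset.sum_div, ← add_div]
  refine div_le_div_of_nonneg_right ?_ (Real.log_nonneg (by norm_num))
  set r : ι → κ → ℝ := fun i k => (μ : Measure Z).real ((fun z => (P z, Q z)) ⁻¹' {(i, k)})
  set p : ι → ℝ := fun i => (μ : Measure Z).real (P ⁻¹' {i})
  set q : κ → ℝ := fun k => (μ : Measure Z).real (Q ⁻¹' {k})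
  have hr1 : ∀ i, ∑ k, r i k = p i := by
    intro i
    have h := sum_real_fibre μ hPQ (Prod.fst ⁻¹' {i})
    rw [Finset.sum_filter, Fintype.sum_prod_type, Finset.sum_eq_single i] at h
    · simpa [p, r, ← Set.preimage_comp, Function.comp_def] using h.symm
    · intro j _ hj
      simp [hj]
    · simp
  have hr2 : ∀ k, ∑ i, r i k = q k := by
    intro k
    have h := sum_real_fibre μ hPQ (Prod.snd ⁻¹' {k})
    rw [Finset.sum_filter, Fintype.sum_prod_type_right, Finset.sum_eq_single k] at h
    · simpa [q, r, ← Set.preimage_comp, Function.comp_def] using h.symm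
    · intro j _ hj
      simp [hj]
    · simp
  have hr0 : ∀ i k, 0 ≤ r i k := fun i k => measureReal_nonneg
  have hp1 : ∑ i, p i = 1 := sum_real_fibre_univ μ hP
  have hq1 : ∑ k, q k = 1 := sum_real_fibre_univ μ hQ
  rw [Fintype.sum_prod_type]
  -- The correction terms `p i * q k - r i k` sum to `1 - 1 = 0`.
  calc ∑ i, ∑ k, Real.negMulLog (r i k)
      ≤ ∑ i, ∑ k, (-r i k * Real.log (p i) + -r i k * Real.log (q k) + (p i * q k - r i k)) := by
        refine Finset.sum_le_sum fun i _ => Finset.sum_le_sum fun k _ =>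
          negMulLog_le_gibbs (hr0 i k) ?_ ?_
        · rw [← hr1 i]
          exact Finset.single_le_sum (f := r i) (fun k _ => hr0 i k) (Finset.mem_univ k)
        · rw [← hr2 k]
          exact Finset.single_le_sum (f := fun i => r i k) (fun i _ => hr0 i k) (Finset.mem_univ i)
    _ = ∑ i, Real.negMulLog (p i) + ∑ k, Real.negMulLog (q k) := by
        simp only [Finset.sum_add_distrib, Finset.sum_sub_distrib]
        rw [Finset.sum_comm (f := fun i k => -r i k * Real.log (q k))]
        simp only [← Finset.sum_mul, ← Finset.mul_sum, Finset.sum_neg_distrib, hr1, hr2, hp1, hq1,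
          Real.negMulLog]
        ring

theorem shannonEntropy_of_subsingleton {ι : Type*} [Fintype ι] [Subsingleton ι] (P : Z → ι) :
    shannonEntropy μ P = 0 := by
  refine Finset.sum_eq_zero fun i _ => ?_
  have : P ⁻¹' {i} = Set.univ := by
    ext z
    simp [Subsingleton.elim (P z) i]
  simp [this]

theorem shannonEntropy_pi_le {κ ι : Type*} [Fintype κ] [DecidableEq κ] [Fintype ι] {P : κ → Z → ι}
    (hP : ∀ k i, MeasurableSet (P k ⁻¹' {i})) :
    shannonEntropy μ (fun z k => P k z) ≤ ∑ k, shannonEntropy μ (P k) := by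
  have key : ∀ s : Finset κ,
      shannonEntropy μ (fun z (k : s) => P k z) ≤ ∑ k ∈ s, shannonEntropy μ (P k) := by
    intro s
    induction s using Finset.induction_on with
    | empty => simpa using (shannonEntropy_of_subsingleton μ _).le
    | insert a s ha ih =>
      have hs := measurableSet_fibre_pi (P := fun (k : s) => P k) fun k => hP k
      rw [Finset.sum_insert ha]
      refine le_trans ?_ ((shannonEntropy_prodMk_le μ (hP a) hs).trans (add_le_add_right ih _))
      refine shannonEntropy_comp_le μ (measurableSet_fibre_prodMk (hP a) hs)
        (fun x k => if h : (k : κ) ∈ s then x.2 ⟨k, h⟩ else x.1) fun z => ?_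
      funext k
      by_cases h : (k : κ) ∈ s
      · simp [h]
      · have : (k : κ) = a := (Finset.mem_insert.1 k.2).resolve_right h
        simp [this, ha]
  refine le_trans ?_ (key Finset.univ)
  exact shannonEntropy_comp_le μ
    (measurableSet_fibre_pi (P := fun (k : (Finset.univ : Finset κ)) => P k) fun k => hP k)
    (fun x k => x ⟨k, Finset.mem_univ k⟩) fun z => rfl

end Shannon

/-! ### Dynamical entropy of a partition. -/

section PartitionEntropy

variable {G Z : Type*} [Semigroup G] [MeasurableSpace Z] {T : G → Z → Z} (hT : ∀ g, Measurable (T g))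
  (μ : ProbabilityMeasure Z)

include hT

omit [Semigroup G] in
theorem measurableSet_fibre_refinement {ι : Type*} [Finite ι] {P : Z → ι}
    (hP : ∀ i, MeasurableSet (P ⁻¹' {i})) (F : Finset G) (a : F → ι) :
    MeasurableSet (refinement T P F ⁻¹' {a}) :=
  measurableSet_fibre_pi (P := fun (g : F) z => P (T g.1 z)) (fun g i => hT g.1 (hP i)) a

theorem partitionEntropy_comp_le {κ ι : Type*} [Fintype κ] [Fintype ι] {Q : Z → κ}
    (hQ : ∀ k, MeasurableSet (Q ⁻¹' {k})) {P : Z → ι} (φ : κ → ι) (hP : ∀ z, P z = φ (Q z)) :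
    partitionEntropy T μ P ≤ partitionEntropy T μ Q := by
  classical
  refine iSup₂_mono fun F _ => limsup_le_limsup (Eventually.of_forall fun n => ?_)
  refine ENNReal.ofReal_le_ofReal (div_le_div_of_nonneg_right ?_ (Nat.cast_nonneg _))
  exact shannonEntropy_comp_le μ (measurableSet_fibre_refinement hT hQ _) (fun x g => φ (x g))
    fun z => funext fun g => hP _

theorem partitionEntropy_prodMk_le {κ ι : Type*} [Fintype κ] [Fintype ι] {P : Z → ι} {Q : Z → κ}
    (hP : ∀ k, MeasurableSet (P ⁻¹' {k})) (hQ : ∀ k, MeasurableSet (Q ⁻¹' {k})) :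
    partitionEntropy T μ (fun z => (P z, Q z)) ≤
      partitionEntropy T μ P + partitionEntropy T μ Q := by
  classical
  refine iSup₂_le fun F hF => ?_
  refine le_trans ?_ (add_le_add (le_iSup₂ (f := fun (F : ℕ → Finset G) (_ : IsFolner F) =>
    limsup (fun n => ENNReal.ofReal (shannonEntropy μ (refinement T P (F n)) / ((F n).card : ℝ)))
      atTop) F hF) (le_iSup₂ (f := fun (F : ℕ → Finset G) (_ : IsFolner F) =>
    limsup (fun n => ENNReal.ofReal (shannonEntropy μ (refinement T Q (F n)) / ((F n).card : ℝ)))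
      atTop) F hF))
  refine le_trans (limsup_le_limsup (Eventually.of_forall fun n => ?_)) (ennreal_limsup_add_le _ _ _)
  refine le_trans (ENNReal.ofReal_le_ofReal ?_) ENNReal.ofReal_add_le
  rw [← add_div]
  refine div_le_div_of_nonneg_right ?_ (Nat.cast_nonneg _)
  have hP' := measurableSet_fibre_refinement hT hP (F n)
  have hQ' := measurableSet_fibre_refinement hT hQ (F n)
  refine le_trans ?_ (shannonEntropy_prodMk_le μ hP' hQ')
  exact shannonEntropy_comp_le μ (measurableSet_fibre_prodMk hP' hQ')
    (fun x g => (x.1 g, x.2 g)) fun z => rfl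

/-- By subadditivity `H(μ, P^F)` is at most the sum of the entropies of the translates `g⁻¹P`, and
invariance makes each of these equal to `H(μ, P)`. -/
theorem partitionEntropy_le_shannonEntropy (hμ : IsInvariantMeasure T μ) {ι : Type*} [Fintype ι]
    {P : Z → ι} (hP : ∀ k, MeasurableSet (P ⁻¹' {k})) :
    partitionEntropy T μ P ≤ ENNReal.ofReal (shannonEntropy μ P) := by
  classical
  refine iSup₂_le fun F hF => limsup_le_of_le (h := Eventually.of_forall fun n => ?_)
  -- For empty `F n` the quotient is `0` by the convention on division by zero.
  rcases Nat.eq_zero_or_pos (F n).card with h0 | h0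
  · simp [h0]
  · refine ENNReal.ofReal_le_ofReal ?_
    rw [div_le_iff₀' (by exact_mod_cast h0)]
    refine (shannonEntropy_pi_le μ (P := fun (g : F n) z => P (T g.1 z))
      fun g i => hT g.1 (hP i)).trans_eq ?_
    have : ∀ g : F n, shannonEntropy μ (fun z => P (T g.1 z)) = shannonEntropy μ P := by
      intro g
      refine Finset.sum_congr rfl fun i _ => ?_
      conv_rhs => rw [← hμ g.1]
      rw [map_measureReal_apply (hT g.1) (hP i)]
      rfl
    simp [this]

theorem partitionEntropy_pi_eq_zero {κ ι : Type*} [Fintype κ] [DecidableEq κ] [Fintype ι]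
    {P : κ → Z → ι} (hP : ∀ k i, MeasurableSet (P k ⁻¹' {i}))
    (h : ∀ k, partitionEntropy T μ (P k) = 0) :
    partitionEntropy T μ (fun z k => P k z) = 0 := by
  have key : ∀ s : Finset κ, partitionEntropy T μ (fun z (k : s) => P k z) = 0 := by
    intro s
    induction s using Finset.induction_on with
    | empty =>
      refine le_antisymm (iSup₂_le fun F hF => ?_) zero_le
      simp [shannonEntropy_of_subsingleton]
    | insert a s ha ih =>
      have hs := measurableSet_fibre_pi (P := fun (k : s) => P k) fun k => hP k
      refine le_antisymm ?_ zero_le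
      have h2 := partitionEntropy_prodMk_le hT μ (hP a) hs
      rw [h, ih, add_zero] at h2
      refine le_trans ?_ h2
      refine partitionEntropy_comp_le hT μ (measurableSet_fibre_prodMk (hP a) hs)
        (fun x k => if h : (k : κ) ∈ s then x.2 ⟨k, h⟩ else x.1) fun z => ?_
      funext k
      by_cases h : (k : κ) ∈ s
      · simp [h]
      · have : (k : κ) = a := (Finset.mem_insert.1 k.2).resolve_right h
        simp [this, ha]
  refine le_antisymm ?_ zero_le
  rw [← key Finset.univ]
  exact partitionEntropy_comp_le hT μ
    (measurableSet_fibre_pi (P := fun (k : (Finset.univ : Finset κ)) => P k) fun k => hP k)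
    (fun x k => x ⟨k, Finset.mem_univ k⟩) fun z => rfl

omit hT in
theorem partitionEntropy_map {X : Type*} [MeasurableSpace X] {S : G → X → X}
    (hS : ∀ g, Measurable (S g)) {π : Z → X} (hπ : Measurable π)
    (hπT : ∀ g z, π (T g z) = S g (π z)) {ι : Type*} [Fintype ι] {P : X → ι}
    (hP : ∀ k, MeasurableSet (P ⁻¹' {k})) :
    partitionEntropy S (μ.map hπ.aemeasurable) P = partitionEntropy T μ (fun z => P (π z)) := by
  classical
  unfold partitionEntropy
  refine iSup_congr fun F => iSup_congr fun hF => ?_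
  refine limsup_congr (Eventually.of_forall fun n => ?_)
  congr 2
  refine Finset.sum_congr rfl fun a _ => ?_
  rw [ProbabilityMeasure.toMeasure_map,
    map_measureReal_apply hπ (measurableSet_fibre_refinement hS hP _ _), ← Set.preimage_comp]
  congr 4
  funext z g
  simp [refinement, hπT]

end PartitionEntropy

/-! ### The Pinsker σ-algebra. -/

section Pinsker

variable {G Z : Type*} [Semigroup G] [MeasurableSpace Z] {T : G → Z → Z} (hT : ∀ g, Measurable (T g))
  {μ : ProbabilityMeasure Z} (hμ : IsInvariantMeasure T μ)

theorem measurableSet_fibre_mem {A : Set Z} (hA : MeasurableSet A) (p : Prop) :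
    MeasurableSet ((fun z => z ∈ A) ⁻¹' {p}) :=
  measurable_mem.2 hA (measurableSet_singleton p)

theorem tendsto_shannonEntropy_mem {R : ℕ → Set Z} (hR : ∀ n, MeasurableSet (R n))
    (h : Tendsto (fun n => (μ : Measure Z).real (R n)) atTop (𝓝 0)) :
    Tendsto (fun n => shannonEntropy μ (fun z => z ∈ R n)) atTop (𝓝 0) := by
  have h1 : ∀ n, shannonEntropy μ (fun z => z ∈ R n) =
      Real.negMulLog ((μ : Measure Z).real (R n)) / Real.log 2 +
        Real.negMulLog (1 - (μ : Measure Z).real (R n)) / Real.log 2 := by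
    intro n
    have e1 : (fun z => z ∈ R n) ⁻¹' {True} = R n := by ext z; simp
    have e2 : (fun z => z ∈ R n) ⁻¹' {False} = (R n)ᶜ := by ext z; simp
    rw [shannonEntropy, Fintype.univ_Prop, Finset.sum_pair (by simp), e1, e2,
      probReal_compl_eq_one_sub (hR n)]
  simp only [h1]
  have hc : Continuous fun x : ℝ => Real.negMulLog x / Real.log 2 +
      Real.negMulLog (1 - x) / Real.log 2 := by fun_prop
  simpa [Function.comp_def] using (hc.tendsto 0).comp h

include hT hμ

/-- Membership in `A` is determined by membership in `B n` and in the error set `A ∆ B n`. The first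
has zero dynamical entropy, and the second costs at most its Shannon entropy, which vanishes in the
limit. -/
theorem partitionEntropy_mem_eq_zero_of_tendsto {A : Set Z} (hA : MeasurableSet A) {B : ℕ → Set Z}
    (hB : ∀ n, MeasurableSet (B n)) (h : ∀ n, partitionEntropy T μ (fun z => z ∈ B n) = 0)
    (hAB : Tendsto (fun n => (μ : Measure Z).real (A ∆ B n)) atTop (𝓝 0)) :
    partitionEntropy T μ (fun z => z ∈ A) = 0 := by
  have hR : ∀ n, MeasurableSet (A ∆ B n) := fun n => hA.symmDiff (hB n)
  have hlim := ENNReal.tendsto_ofReal (tendsto_shannonEntropy_mem (μ := μ) hR hAB)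
  rw [ENNReal.ofReal_zero] at hlim
  refine le_antisymm (ge_of_tendsto' hlim fun n => ?_) zero_le
  refine le_trans ?_ (partitionEntropy_le_shannonEntropy hT μ hμ (measurableSet_fibre_mem (hR n)))
  have h2 := partitionEntropy_prodMk_le hT μ (measurableSet_fibre_mem (hB n))
    (measurableSet_fibre_mem (hR n))
  rw [h, zero_add] at h2
  refine le_trans ?_ h2
  refine partitionEntropy_comp_le hT μ (measurableSet_fibre_prodMk (measurableSet_fibre_mem (hB n))
    (measurableSet_fibre_mem (hR n))) (fun x => Xor x.1 x.2) fun z => ?_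
  simp only [Set.mem_symmDiff, xor_def, eq_iff_iff]
  tauto

theorem partitionEntropy_mem_eq_zero_of_ae_eq {A B : Set Z} (hA : MeasurableSet A)
    (hB : MeasurableSet B) (h : partitionEntropy T μ (fun z => z ∈ B) = 0)
    (hAB : A =ᵐ[(μ : Measure Z)] B) : partitionEntropy T μ (fun z => z ∈ A) = 0 := by
  refine partitionEntropy_mem_eq_zero_of_tendsto hT hμ hA (fun _ => hB) (fun _ => h) ?_
  have : (μ : Measure Z).real (A ∆ B) = 0 := by
    rw [Measure.real, measure_symmDiff_eq_zero_iff.2 hAB, ENNReal.toReal_zero]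
  simp [this]

omit hμ in
theorem partitionEntropy_mem_union {A B : Set Z} (hA : MeasurableSet A) (hB : MeasurableSet B)
    (hA0 : partitionEntropy T μ (fun z => z ∈ A) = 0)
    (hB0 : partitionEntropy T μ (fun z => z ∈ B) = 0) :
    partitionEntropy T μ (fun z => z ∈ A ∪ B) = 0 := by
  have h2 := partitionEntropy_prodMk_le hT μ (measurableSet_fibre_mem hA)
    (measurableSet_fibre_mem hB)
  rw [hA0, hB0, zero_add] at h2
  refine le_antisymm (le_trans ?_ h2) zero_le
  exact partitionEntropy_comp_le hT μ (measurableSet_fibre_prodMk (measurableSet_fibre_mem hA)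
    (measurableSet_fibre_mem hB)) (fun x => x.1 ∨ x.2) fun z => rfl

/-- The Pinsker σ-algebra: the measurable sets `A` such that the partition `{A, Aᶜ}` has zero
dynamical entropy. -/
@[reducible] def pinskerAlgebra : MeasurableSpace Z where
  MeasurableSet' A := MeasurableSet A ∧ partitionEntropy T μ (fun z => z ∈ A) = 0
  measurableSet_empty := by
    refine ⟨MeasurableSet.empty, ?_⟩
    refine le_antisymm ((partitionEntropy_le_shannonEntropy hT μ hμ
      (measurableSet_fibre_mem MeasurableSet.empty)).trans_eq ?_) zero_le
    -- The trivial partition is treated as a constant sequence of sets of measure zero, whose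
    -- entropies tend to `0`.
    have h0 := tendsto_shannonEntropy_mem (μ := μ) (R := fun _ => ∅)
      (fun _ => MeasurableSet.empty) (by simp)
    rw [tendsto_nhds_unique h0 tendsto_const_nhds |>.symm, ENNReal.ofReal_zero]
  measurableSet_compl A hA := by
    refine ⟨hA.1.compl, le_antisymm (le_trans ?_ hA.2.le) zero_le⟩
    exact partitionEntropy_comp_le hT μ (measurableSet_fibre_mem hA.1) Not fun z => rfl
  measurableSet_iUnion A hA := by
    have hm : ∀ n, MeasurableSet (Set.accumulate A n) := fun n => by
      rw [Set.accumulate_def]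
      exact MeasurableSet.biUnion (Set.to_countable _) fun k _ => (hA k).1
    have h0 : ∀ n, partitionEntropy T μ (fun z => z ∈ Set.accumulate A n) = 0 := by
      intro n
      induction n with
      | zero => simpa using (hA 0).2
      | succ n ih =>
        rw [Set.accumulate_succ]
        exact partitionEntropy_mem_union hT (hm n) (hA _).1 ih (hA _).2
    have hU := MeasurableSet.iUnion fun n => (hA n).1
    -- The finite unions increase to the full union, so they approximate it in measure.
    refine ⟨hU, partitionEntropy_mem_eq_zero_of_tendsto hT hμ hU hm h0 ?_⟩
    have hsub : ∀ n, Set.accumulate A n ⊆ ⋃ i, A i := fun n => Set.accumulate_subset_iUnion n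
    have h1 : ∀ n, (μ : Measure Z).real ((⋃ i, A i) ∆ Set.accumulate A n) =
        (μ : Measure Z).real (⋃ i, A i) - (μ : Measure Z).real (Set.accumulate A n) := by
      intro n
      rw [Set.symmDiff_def, Set.sdiff_eq_empty.2 (hsub n), Set.union_empty,
        measureReal_sdiff (hsub n) (hm n)]
    simp only [h1]
    have h2 := (ENNReal.tendsto_toReal (measure_ne_top (μ : Measure Z) _)).comp
      (tendsto_measure_iUnion_accumulate (μ := (μ : Measure Z)) (f := A))
    simpa [Measure.real, Function.comp_def] using
      (tendsto_const_nhds (x := (μ : Measure Z).real (⋃ i, A i))).sub h2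

theorem comap_le_pinskerAlgebra {X : Type*} [mX : MeasurableSpace X] {S : G → X → X}
    (hS : ∀ g, Measurable (S g)) {π : Z → X} (hπ : Measurable π)
    (hπT : ∀ g z, π (T g z) = S g (π z)) (h : ksEntropy S (μ.map hπ.aemeasurable) = 0) :
    MeasurableSpace.comap π mX ≤ pinskerAlgebra hT hμ := by
  classical
  rintro _ ⟨A, hA, rfl⟩
  refine ⟨hπ hA, ?_⟩
  rw [show (fun z => z ∈ π ⁻¹' A) = fun z => (fun x => x ∈ A) (π z) from rfl,
    ← partitionEntropy_map μ hS hπ hπT (measurableSet_fibre_mem hA)]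
  let P : X → Fin 2 := fun x => if x ∈ A then 0 else 1
  have hP : Measurable P := Measurable.ite hA measurable_const measurable_const
  refine le_antisymm (le_trans ?_ ((le_iSup₂_of_le 2 P (le_iSup_of_le hP le_rfl)).trans h.le))
    zero_le
  refine partitionEntropy_comp_le hS _ (fun k => hP (measurableSet_singleton k)) (fun i => i = 0)
    fun x => ?_
  by_cases hx : x ∈ A <;> simp [P, hx]

omit hμ in
-- A finite partition is the join of the two-cell partitions given by its cells, and a finite join
-- of zero-entropy partitions has zero entropy.
theorem ksEntropy_eq_zero_of_forall_mem
    (h : ∀ A, MeasurableSet A → partitionEntropy T μ (fun z => z ∈ A) = 0) :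
    ksEntropy T μ = 0 := by
  refine le_antisymm (iSup₂_le fun k P => iSup_le fun hP => ?_) zero_le
  have hA : ∀ i, MeasurableSet (P ⁻¹' {i}) := fun i => hP (measurableSet_singleton i)
  rw [← partitionEntropy_pi_eq_zero hT μ (P := fun i z => z ∈ P ⁻¹' {i})
    (fun i => measurableSet_fibre_mem (hA i)) fun i => h _ (hA i)]
  classical
  refine partitionEntropy_comp_le hT μ
    (measurableSet_fibre_pi fun i => measurableSet_fibre_mem (hA i))
    -- The label is recovered as the index of the cell containing the point; the `else` value is
    -- arbitrary and never reached.
    (fun x => if hx : ∃ i, x i then hx.choose else P (Classical.choice μ.nonempty)) fun z => ?_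
  have hx : ∃ i, z ∈ P ⁻¹' {i} := ⟨P z, rfl⟩
  rw [dif_pos hx]
  exact hx.choose_spec

end Pinsker

/-! ### Strongly deterministic functions. -/

section StronglyDeterministic

variable {G : Type*} [Semigroup G]

omit [Semigroup G] in
theorem IsInvariantMeasure.map {Z X : Type*} [MeasurableSpace Z] [MeasurableSpace X]
    {T : G → Z → Z} (hT : ∀ g, Measurable (T g)) {μ : ProbabilityMeasure Z}
    (hμ : IsInvariantMeasure T μ) {S : G → X → X} (hS : ∀ g, Measurable (S g)) {π : Z → X}
    (hπ : Measurable π) (hπT : ∀ g z, π (T g z) = S g (π z)) :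
    IsInvariantMeasure S (μ.map hπ.aemeasurable) := by
  intro g
  rw [ProbabilityMeasure.toMeasure_map, Measure.map_map (hS g) hπ,
    show S g ∘ π = π ∘ T g from funext fun z => (hπT g z).symm, ← Measure.map_map hπ (hT g), hμ g]

/-- The product σ-algebra is generated by the coordinate factors, each of which lies in the Pinsker
algebra. -/
theorem ksEntropy_pi_eq_zero {κ : Type*} {X : κ → Type*} [∀ k, MeasurableSpace (X k)]
    {S : ∀ k, G → X k → X k} (hS : ∀ k g, Measurable (S k g))
    {μ : ProbabilityMeasure (∀ k, X k)} (hμ : IsInvariantMeasure (fun g x k => S k g (x k)) μ)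
    (h : ∀ k, ksEntropy (S k) (μ.map (measurable_pi_apply k).aemeasurable) = 0) :
    ksEntropy (fun g x k => S k g (x k)) μ = 0 := by
  have hT : ∀ g : G, Measurable fun (x : ∀ k, X k) k => S k g (x k) := fun g =>
    measurable_pi_lambda _ fun k => (hS k g).comp (measurable_pi_apply k)
  have hle : (MeasurableSpace.pi : MeasurableSpace (∀ k, X k)) ≤ pinskerAlgebra hT hμ :=
    iSup_le fun k => comap_le_pinskerAlgebra hT hμ (hS k) (measurable_pi_apply k)
      (fun g x => rfl) (h k)
  exact ksEntropy_eq_zero_of_forall_mem hT fun A hA => (hle A hA).2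

theorem topEntropy_eq_zero_iff {X : Type*} [MeasurableSpace X] {T : G → X → X} :
    topEntropy T = 0 ↔ ∀ μ : ProbabilityMeasure X, IsInvariantMeasure T μ → ksEntropy T μ = 0 := by
  simp [topEntropy]

/-- The countable product of dynamical systems. -/
@[reducible] noncomputable def System.pi (S : ℕ → System G) : System G where
  X := ∀ n, (S n).X
  -- Any metric inducing the product topology serves.
  metric := TopologicalSpace.metrizableSpaceMetric (∀ n, (S n).X)
  compact := inferInstanceAs (CompactSpace (∀ n, (S n).X))
  meas := MeasurableSpace.pi
  borel := inferInstanceAs (BorelSpace (∀ n, (S n).X))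
  act g x n := (S n).act g (x n)
  act_continuous g := continuous_pi fun n => ((S n).act_continuous g).comp (continuous_apply n)
  act_mul g h x := funext fun n => (S n).act_mul g h (x n)
  act_unit e he x := funext fun n => (S n).act_unit e he (x n)

theorem System.measurable_act (S : System G) (g : G) : Measurable (S.act g) :=
  (S.act_continuous g).measurable

theorem System.topEntropy_pi_eq_zero (S : ℕ → System G) (h : ∀ n, topEntropy (S n).act = 0) :
    topEntropy (System.pi S).act = 0 := by
  rw [topEntropy_eq_zero_iff]
  intro μ hμ
  refine ksEntropy_pi_eq_zero (S := fun n => (S n).act) (fun n g => (S n).measurable_act g) hμ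
    fun n => topEntropy_eq_zero_iff.1 (h n) _ ?_
  exact hμ.map (System.pi S).measurable_act (S n).measurable_act (measurable_pi_apply n) fun g x => rfl

theorem StronglyDeterministic.continuous_comp {f : ℕ → G → ℝ}
    (hf : ∀ n, StronglyDeterministic (f n)) {Ψ : (ℕ → ℝ) → ℝ} (hΨ : Continuous Ψ) :
    StronglyDeterministic fun g => Ψ fun n => f n g := by
  choose S φ x h0 hφ hfx using hf
  refine ⟨System.pi S, fun y => Ψ fun n => φ n (y n), x, System.topEntropy_pi_eq_zero S h0, ?_,
    fun g => by simp only [hfx]⟩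
  exact hΨ.comp (continuous_pi fun n => (hφ n).comp (continuous_apply n))

/-- The system with one point. -/
@[reducible] def System.unit : System G where
  X := Unit
  act _ x := x
  act_continuous _ := continuous_id
  act_mul _ _ _ := rfl
  act_unit _ _ _ := rfl

theorem StronglyDeterministic.const (c : ℝ) : StronglyDeterministic fun _ : G => c := by
  refine ⟨System.unit, fun _ => c, (), ?_, continuous_const, fun _ => rfl⟩
  refine topEntropy_eq_zero_iff.2 fun μ hμ =>
    ksEntropy_eq_zero_of_forall_mem System.unit.measurable_act fun A hA => ?_
  refine le_antisymm ((partitionEntropy_comp_le System.unit.measurable_act μ (Q := fun _ => ())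
    (fun k => MeasurableSet.of_discrete) (fun _ => () ∈ A) fun z => rfl).trans ?_) zero_le
  refine iSup₂_le fun F hF => ?_
  simp [shannonEntropy_of_subsingleton]

theorem StronglyDeterministic.binary {f h : G → ℝ} (hf : StronglyDeterministic f)
    (hh : StronglyDeterministic h) {ψ : ℝ → ℝ → ℝ} (hψ : Continuous fun p : ℝ × ℝ => ψ p.1 p.2) :
    StronglyDeterministic fun g => ψ (f g) (h g) := by
  -- The pair is encoded as the sequence `f, h, h, …`.
  have := StronglyDeterministic.continuous_comp (f := fun n => if n = 0 then f else h)
    (fun n => by by_cases hn : n = 0 <;> simp [hn, hf, hh]) (Ψ := fun a => ψ (a 0) (a 1))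
    (hψ.comp (f := fun a : ℕ → ℝ => (a 0, a 1))
      ((continuous_apply 0).prodMk (continuous_apply 1)))
  simpa using this

/-- A uniform limit of functions is a continuous function of the sequence. -/
theorem exists_continuous_of_tendstoUniformly {α : Type*} {f : ℕ → α → ℝ} {f₀ : α → ℝ}
    (h : TendstoUniformly f f₀ atTop) :
    ∃ Ψ : (ℕ → ℝ) → ℝ, Continuous Ψ ∧ ∀ x, f₀ x = Ψ fun n => f n x := by
  -- The Cauchy estimate is uniform on the range of `x ↦ (f n x)`, and passes to the closure as a
  -- non-strict inequality. Thus the limit is continuous on the closed set `D` and extends by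
  -- Tietze.
  set D : Set (ℕ → ℝ) := closure (Set.range fun x n => f n x)
  have hC : UniformCauchySeqOn (fun (n : ℕ) (a : ℕ → ℝ) => a n) atTop D := by
    have h1 := h.tendstoUniformlyOn (s := Set.univ) |>.uniformCauchySeqOn
    rw [Metric.uniformCauchySeqOn_iff] at h1 ⊢
    intro ε hε
    obtain ⟨N, hN⟩ := h1 (ε / 2) (half_pos hε)
    refine ⟨N, fun m hm n hn a ha => lt_of_le_of_lt ?_ (half_lt_self hε)⟩
    have hcl : IsClosed {a : ℕ → ℝ | dist (a m) (a n) ≤ ε / 2} :=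
      isClosed_le ((continuous_apply m).dist (continuous_apply n)) continuous_const
    refine closure_minimal ?_ hcl ha
    rintro _ ⟨x, rfl⟩
    exact (hN m hm n hn x (Set.mem_univ x)).le
  have hlim : ∀ a ∈ D, Tendsto (fun n => a n) atTop (𝓝 (limUnder atTop a)) :=
    fun a ha => (hC.cauchySeq ha).tendsto_limUnder
  have hcont := (hC.tendstoUniformlyOn_of_tendsto hlim).continuousOn
    (Frequently.of_forall fun n => (continuous_apply n).continuousOn)
  obtain ⟨Ψ, hΨ⟩ := ContinuousMap.exists_restrict_eq isClosed_closure
    (⟨D.domRestrict fun a => limUnder atTop a, hcont.domRestrict⟩ : C(D, ℝ))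
  refine ⟨Ψ, Ψ.continuous, fun x => ?_⟩
  have hx : (fun n => f n x) ∈ D := subset_closure ⟨x, rfl⟩
  have h2 : Ψ (fun n => f n x) = limUnder atTop fun n => f n x := congr($hΨ ⟨_, hx⟩)
  rw [h2]
  exact tendsto_nhds_unique (h.tendsto_at x) (hlim _ hx)

theorem StronglyDeterministic.of_tendstoUniformly {f : ℕ → G → ℝ} {f₀ : G → ℝ}
    (hf : ∀ n, StronglyDeterministic (f n)) (h : TendstoUniformly f f₀ atTop) :
    StronglyDeterministic f₀ := by
  obtain ⟨Ψ, hΨ, hΨf⟩ := exists_continuous_of_tendstoUniformly h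
  rw [funext hΨf]
  exact StronglyDeterministic.continuous_comp hf hΨ

variable (G) in
/-- The algebra of strongly deterministic functions. -/
def stronglyDeterministicSubalgebra : Subalgebra ℝ (G → ℝ) where
  carrier := {f | StronglyDeterministic f}
  mul_mem' hf hh := StronglyDeterministic.binary hf hh (ψ := fun a b => a * b) continuous_mul
  add_mem' hf hh := StronglyDeterministic.binary hf hh (ψ := fun a b => a + b) continuous_add
  algebraMap_mem' c := StronglyDeterministic.const c

end StronglyDeterministic

/-! ### Limits of averages along orbits. -/

section OrbitAverage

variable {G X : Type*} [MeasurableSpace X]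

theorem toMeasure_orbitAverage (T : G → X → X) (x : X) (F : Finset G) :
    (orbitAverage T x F : Measure X) =
      (F.card : ℝ≥0)⁻¹ • ∑ g ∈ F, Measure.dirac (T g x) := by
  rw [orbitAverage, FiniteMeasure.toMeasure_smul, FiniteMeasure.toMeasure_sum]
  rfl

theorem map_orbitAverage {Y : Type*} [MeasurableSpace Y] {T : G → X → X} {S : G → Y → Y}
    {π : X → Y} (hπ : Measurable π) (hπT : ∀ g z, π (T g z) = S g (π z)) (x : X) (F : Finset G) :
    (orbitAverage T x F).map π = orbitAverage S (π x) F := by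
  change FiniteMeasure.mapHom hπ _ = _
  rw [orbitAverage, map_smul, map_sum, orbitAverage]
  congr 1
  refine Finset.sum_congr rfl fun g _ => FiniteMeasure.toMeasure_injective ?_
  change (Measure.dirac (T g x)).map π = Measure.dirac (S g (π x))
  rw [Measure.map_dirac' hπ, hπT]

theorem mass_orbitAverage (T : G → X → X) (x : X) {F : Finset G} (hF : F.Nonempty) :
    (orbitAverage T x F).mass = 1 := by
  have h0 : (F.card : ℝ≥0) ≠ 0 := by exact_mod_cast hF.card_pos.ne'
  have : (orbitAverage T x F : Measure X) Set.univ = 1 := by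
    rw [toMeasure_orbitAverage, Measure.smul_apply, Measure.finsetSum_apply]
    simp only [measure_univ, Finset.sum_const, nsmul_eq_mul, mul_one]
    rw [ENNReal.smul_def, smul_eq_mul, ENNReal.coe_inv h0]
    exact ENNReal.inv_mul_cancel (by exact_mod_cast h0) (by simp)
  exact ENNReal.coe_injective (by rw [FiniteMeasure.ennreal_mass, this]; rfl)

theorem integral_orbitAverage [MeasurableSingletonClass X] (T : G → X → X) (x : X) (F : Finset G)
    (φ : X → ℝ) :
    ∫ z, φ z ∂(orbitAverage T x F : Measure X) = (F.card : ℝ)⁻¹ * ∑ g ∈ F, φ (T g x) := by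
  rw [toMeasure_orbitAverage, integral_smul_nnreal_measure, integral_finsetSum_measure]
  · simp [NNReal.smul_def]
  · intro g _
    exact integrable_dirac (by simp)

variable [TopologicalSpace X] [BorelSpace X]

theorem exists_tendsto_orbitAverage [CompactSpace X] [T2Space X] (T : G → X → X) (x : X)
    {F : ℕ → Finset G} (U : Ultrafilter ℕ) (hF : ∀ᶠ n in (U : Filter ℕ), (F n).Nonempty) :
    ∃ μ : ProbabilityMeasure X,
      Tendsto (fun n => orbitAverage T x (F n)) U (𝓝 μ.toFiniteMeasure) := by
  obtain ⟨ν, hν, hle⟩ :=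
    (isCompact_setOfPred_finiteMeasure_eq_of_compactSpace X 1).ultrafilter_le_nhds
    (U.map fun n => orbitAverage T x (F n))
    (by
      rw [le_principal_iff]
      exact hF.mono fun n hn => mass_orbitAverage T x hn)
  rw [← ProbabilityMeasure.range_toFiniteMeasure] at hν
  obtain ⟨μ, rfl⟩ := hν
  exact ⟨μ, hle⟩

/-- A closed condition satisfied along the orbit passes to the limit measure: every average
integrates `ψ` to `0`, hence so does `μ`. -/
theorem ae_eq_zero_of_tendsto_orbitAverage [CompactSpace X] [T2Space X] {T : G → X → X} {x : X}
    {F : ℕ → Finset G} {U : Filter ℕ} [U.NeBot] {μ : FiniteMeasure X}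
    (hμ : Tendsto (fun n => orbitAverage T x (F n)) U (𝓝 μ)) {ψ : X → ℝ} (hψ : Continuous ψ)
    (h0 : ∀ z, 0 ≤ ψ z) (h : ∀ g, ψ (T g x) = 0) : ∀ᵐ z ∂(μ : Measure X), ψ z = 0 := by
  have h1 := FiniteMeasure.tendsto_iff_forall_integral_tendsto.1 hμ
    (BoundedContinuousFunction.mkOfCompact ⟨ψ, hψ⟩)
  simp only [BoundedContinuousFunction.mkOfCompact_apply, ContinuousMap.coe_mk,
    integral_orbitAverage, h, Finset.sum_const_zero, mul_zero] at h1
  have h2 := tendsto_nhds_unique h1 tendsto_const_nhds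
  have hint : Integrable ψ (μ : Measure X) :=
    (BoundedContinuousFunction.mkOfCompact ⟨ψ, hψ⟩).integrable (μ : Measure X)
  exact (integral_eq_zero_iff_of_nonneg h0 hint).1 h2

open Classical in
theorem abs_sum_sub_sum_le {α : Type*} (A B : Finset α) (u : α → ℝ) {C : ℝ}
    (hu : ∀ a, |u a| ≤ C) : |∑ a ∈ A, u a - ∑ a ∈ B, u a| ≤ (A ∆ B).card * C := by
  have h : ∑ a ∈ A, u a - ∑ a ∈ B, u a = ∑ a ∈ A \ B, u a - ∑ a ∈ B \ A, u a := by
    rw [← Finset.sum_sdiff_sub_sum_sdiff]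
  rw [h, symmDiff_def, Finset.sup_eq_union, Finset.card_union_of_disjoint disjoint_sdiff_sdiff,
    Nat.cast_add, add_mul]
  refine (abs_sub _ _).trans (add_le_add ?_ ?_) <;>
  · refine (Finset.abs_sum_le_sum_abs _ _).trans ((Finset.sum_le_sum fun a _ => hu a).trans_eq ?_)
    simp

theorem IsFolner.eventually_nonempty [Semigroup G] [Nonempty G] {F : ℕ → Finset G}
    (hF : IsFolner F) : ∀ᶠ n in atTop, (F n).Nonempty :=
  (hF {Classical.arbitrary G} (Finset.singleton_nonempty _) 1 one_pos).mono fun _ h => h.1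

theorem isInvariantMeasure_of_tendsto_orbitAverage [Semigroup G] [IsLeftCancelMul G]
    [HasOuterApproxClosed X] [T1Space X] {T : G → X → X} (hT : ∀ g, Continuous (T g))
    (hmul : ∀ g h x, T (g * h) x = T g (T h x)) {x : X} {F : ℕ → Finset G} (hF : IsFolner F)
    {U : Filter ℕ} [U.NeBot] (hU : U ≤ atTop) {μ : ProbabilityMeasure X}
    (hμ : Tendsto (fun n => orbitAverage T x (F n)) U (𝓝 μ.toFiniteMeasure)) :
    IsInvariantMeasure T μ := by
  classical
  intro h
  have : IsFiniteMeasure ((μ : Measure X).map (T h)) := Measure.isFiniteMeasure_map _ _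
  refine ext_of_forall_integral_eq_of_IsFiniteMeasure fun φ => ?_
  rw [integral_map (hT h).measurable.aemeasurable φ.continuous.aestronglyMeasurable]
  have h1 := FiniteMeasure.tendsto_iff_forall_integral_tendsto.1 hμ φ
  have h2 := FiniteMeasure.tendsto_iff_forall_integral_tendsto.1 hμ
    (φ.compContinuous ⟨T h, hT h⟩)
  simp only [integral_orbitAverage] at h1 h2
  refine sub_eq_zero.1 (tendsto_nhds_unique (h2.sub h1) ?_)
  rw [Metric.tendsto_nhds]
  intro ε hε
  -- The `+ 1` covers `φ = 0` and makes the final inequality strict.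
  have hpos : 0 < ε / (‖φ‖ + 1) := by positivity
  filter_upwards [hU (hF {h} (Finset.singleton_nonempty h) _ hpos)] with n hn
  obtain ⟨hne, hle⟩ := hn
  have hc : (0 : ℝ) < (F n).card := by exact_mod_cast hne.card_pos
  have hs : ∑ g ∈ F n, (φ.compContinuous ⟨T h, hT h⟩) (T g x) =
      -- Left cancellation makes `g ↦ h * g` injective, so translating by `h` loses no terms.
      ∑ g ∈ {h} * F n, φ (T g x) := by
    have himage : {h} * F n = (F n).image (h * ·) := by
      ext a
      simp [Finset.mem_mul]
    rw [himage, Finset.sum_image fun a _ b _ hab => mul_left_cancel hab]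
    simp [hmul]
  rw [hs, ← mul_sub, Real.dist_eq, sub_zero, abs_mul, abs_inv, abs_of_pos hc]
  have hb := abs_sum_sub_sum_le ({h} * F n) (F n) (fun g => φ (T g x)) (C := ‖φ‖)
    fun g => φ.norm_coe_le_norm _
  calc ((F n).card : ℝ)⁻¹ * |∑ g ∈ {h} * F n, φ (T g x) - ∑ g ∈ F n, φ (T g x)|
      ≤ ((F n).card : ℝ)⁻¹ * ((({h} * F n) ∆ F n).card * ‖φ‖) := by gcongr
    _ = ((({h} * F n) ∆ F n).card / (F n).card) * ‖φ‖ := by ring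
    _ ≤ ε / (‖φ‖ + 1) * ‖φ‖ := by gcongr
    _ < ε := by
      rw [div_mul_eq_mul_div, div_lt_iff₀ (by positivity)]
      nlinarith [norm_nonneg φ]

end OrbitAverage

/-! ### Uniform limits of `F`-deterministic functions. -/

section Limit

variable {G : Type*} [Semigroup G]

theorem measurable_shift {I : Type*} [MeasurableSpace I] (g : G) :
    Measurable (shift g : (G → I) → G → I) :=
  measurable_pi_lambda _ fun h => measurable_pi_apply (h * g)

theorem continuous_shift {I : Type*} [TopologicalSpace I] (g : G) :
    Continuous (shift g : (G → I) → G → I) :=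
  continuous_pi fun h => continuous_apply (h * g)

theorem shift_mul {I : Type*} (g h : G) (x : G → I) : shift (g * h) x = shift g (shift h x) := by
  funext k
  simp [shift, mul_assoc]

/-- The diagonal shift on `I₀^G × ∏ₙ (I n)^G`. -/
def jointShift {I₀ : Type*} {I : ℕ → Type*} (g : G) (z : (G → I₀) × (∀ n, G → I n)) :
    (G → I₀) × (∀ n, G → I n) :=
  (shift g z.1, fun n => shift g (z.2 n))

theorem continuous_jointShift {I₀ : Type*} {I : ℕ → Type*} [TopologicalSpace I₀]
    [∀ n, TopologicalSpace (I n)] (g : G) :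
    Continuous (jointShift g : (G → I₀) × (∀ n, G → I n) → _) :=
  ((continuous_shift g).comp continuous_fst).prodMk
    (continuous_pi fun n => (continuous_shift g).comp ((continuous_apply n).comp continuous_snd))

theorem measurable_jointShift {I₀ : Type*} {I : ℕ → Type*} [MeasurableSpace I₀]
    [∀ n, MeasurableSpace (I n)] (g : G) :
    Measurable (jointShift g : (G → I₀) × (∀ n, G → I n) → _) :=
  ((measurable_shift g).comp measurable_fst).prodMk
    (measurable_pi_lambda _ fun n =>
      (measurable_shift g).comp ((measurable_pi_apply n).comp measurable_snd))

theorem ksEntropy_shift_eq_zero_of_ae_tendsto [Countable G] {I₀ : Set ℝ} {I : ℕ → Set ℝ}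
    {μ : ProbabilityMeasure ((G → I₀) × (∀ n, G → I n))}
    (hμ : IsInvariantMeasure jointShift μ)
    (h : ∀ n, ksEntropy (shift : G → (G → I n) → G → I n)
      (μ.map ((measurable_pi_apply n).comp measurable_snd).aemeasurable) = 0)
    (hlim : ∀ g : G, ∀ᵐ z ∂(μ : Measure ((G → I₀) × (∀ n, G → I n))),
      Tendsto (fun n => (z.2 n g : ℝ)) atTop (𝓝 (z.1 g : ℝ))) :
    ksEntropy (shift : G → (G → I₀) → G → I₀) (μ.map measurable_fst.aemeasurable) = 0 := by
  have hsnd : ∀ n, Measurable[pinskerAlgebra measurable_jointShift hμ]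
      fun z : (G → I₀) × (∀ n, G → I n) => z.2 n := fun n =>
    Measurable.of_comap_le <| comap_le_pinskerAlgebra measurable_jointShift hμ measurable_shift
      ((measurable_pi_apply n).comp measurable_snd) (fun g z => rfl) (h n)
  have hcoord : ∀ g n, Measurable[pinskerAlgebra measurable_jointShift hμ]
      fun z : (G → I₀) × (∀ n, G → I n) => (z.2 n g : ℝ) := fun g n =>
    measurable_subtype_coe.comp ((measurable_pi_apply g).comp (hsnd n))
  have hfst0 : ∀ g, Measurable[pinskerAlgebra measurable_jointShift hμ]
      fun z : (G → I₀) × (∀ n, G → I n) => (z.1 g : ℝ) := by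
    intro g B hB
    -- The upper limit is defined everywhere and Pinsker measurable; it agrees a.e. with `z.1 g`,
    -- and null modifications stay in the Pinsker algebra.
    have hL : Measurable[pinskerAlgebra measurable_jointShift hμ]
        fun z : (G → I₀) × (∀ n, G → I n) => limsup (fun n => (z.2 n g : ℝ)) atTop := by
      let _ := pinskerAlgebra measurable_jointShift hμ
      exact Measurable.limsup (hcoord g)
    have hLB := hL hB
    have hA : MeasurableSet ((fun z : (G → I₀) × (∀ n, G → I n) => (z.1 g : ℝ)) ⁻¹' B) :=
      (measurable_subtype_coe.comp ((measurable_pi_apply g).comp measurable_fst)) hB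
    refine ⟨hA, partitionEntropy_mem_eq_zero_of_ae_eq measurable_jointShift hμ hA hLB.1 hLB.2 ?_⟩
    filter_upwards [hlim g] with z hz
    refine eq_iff_iff.2 ?_
    change (z.1 g : ℝ) ∈ B ↔ limsup (fun n => (z.2 n g : ℝ)) atTop ∈ B
    rw [hz.limsup_eq]
  have hfst : Measurable[pinskerAlgebra measurable_jointShift hμ]
      (Prod.fst : (G → I₀) × (∀ n, G → I n) → G → I₀) :=
    @measurable_pi_lambda _ _ _ (pinskerAlgebra measurable_jointShift hμ) _ _ fun g =>
      @Measurable.subtype_mk _ _ (pinskerAlgebra measurable_jointShift hμ) _ _ _ (hfst0 g) _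
  refine ksEntropy_eq_zero_of_forall_mem measurable_shift fun A hA => ?_
  rw [partitionEntropy_map μ measurable_shift measurable_fst (T := jointShift) (fun g z => rfl)
    (measurableSet_fibre_mem hA)]
  exact (hfst hA).2

theorem FDeterministic.of_tendstoUniformly [IsLeftCancelMul G] [Countable G] [Nonempty G]
    {F : ℕ → Finset G} (hF : IsFolner F) {f : ℕ → G → ℝ} {f₀ : G → ℝ}
    (hf : ∀ n, FDeterministic F (f n)) (h : TendstoUniformly f f₀ atTop) :
    FDeterministic F f₀ := by
  choose I hI hfI hdet using hf
  rw [Metric.tendstoUniformly_iff] at h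
  obtain ⟨N, hN⟩ := (h 1 one_pos).exists
  obtain ⟨R, hR⟩ := (hI N).isBounded.subset_closedBall 0
  obtain ⟨I₀, hI₀, hf₀⟩ : ∃ I₀ : Set ℝ, IsCompact I₀ ∧ ∀ g, f₀ g ∈ I₀ :=
    ⟨_, isCompact_closedBall (0 : ℝ) (1 + R), fun g =>
      Metric.mem_closedBall.2 ((dist_triangle _ (f N g) _).trans
        (add_le_add (hN g).le (Metric.mem_closedBall.1 (hR (hfI N g)))))⟩
  refine ⟨I₀, hI₀, hf₀, fun μ _ hgen => ?_⟩
  have : CompactSpace I₀ := isCompact_iff_compactSpace.1 hI₀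
  have : ∀ n, CompactSpace (I n) := fun n => isCompact_iff_compactSpace.1 (hI n)
  -- Along an ultrafilter the joint averages converge by compactness, with no passage to
  -- subsequences, and their first marginal must be `μ`.
  obtain ⟨U, hU, hUμ⟩ := mapClusterPt_iff_ultrafilter.1 hgen
  let x : (G → I₀) × (∀ n, G → I n) := (fun g => ⟨f₀ g, hf₀ g⟩, fun n g => ⟨f n g, hfI n g⟩)
  obtain ⟨ν, hν⟩ := exists_tendsto_orbitAverage jointShift x U (hU hF.eventually_nonempty)
  have hνinv : IsInvariantMeasure jointShift ν :=
    isInvariantMeasure_of_tendsto_orbitAverage continuous_jointShift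
      (fun g h z => by simp [jointShift, shift_mul]) hF hU hν
  have hfst : ν.map measurable_fst.aemeasurable = μ := by
    have h1 := FiniteMeasure.tendsto_map_of_tendsto_of_continuous _ _ hν continuous_fst
    simp only [map_orbitAverage (T := jointShift) (S := shift) measurable_fst fun g z => rfl] at h1
    exact (ProbabilityMeasure.toFiniteMeasure_isEmbedding _).injective
      (tendsto_nhds_unique h1 hUμ)
  rw [← hfst]
  refine ksEntropy_shift_eq_zero_of_ae_tendsto hνinv (fun n => ?_) fun g => ?_
  · have hc : Continuous fun z : (G → I₀) × (∀ n, G → I n) => z.2 n :=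
      (continuous_apply n).comp continuous_snd
    have h1 := FiniteMeasure.tendsto_map_of_tendsto_of_continuous _ _ hν hc
    simp only [map_orbitAverage (T := jointShift) (S := shift) hc.measurable fun g z => rfl] at h1
    -- The marginal over `f n` is an invariant accumulation point of the averages of `f n`, so
    -- `hdet` applies to it.
    have hinv := isInvariantMeasure_of_tendsto_orbitAverage continuous_shift shift_mul hF hU
      (μ := ν.map hc.measurable.aemeasurable) h1
    exact hdet n _ hinv (mapClusterPt_iff_ultrafilter.2 ⟨U, hU, h1⟩)
  · have key : ∀ p : ℕ × ℕ, (∀ g, dist (f₀ g) (f p.2 g) < 1 / ((p.1 : ℝ) + 1)) →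
        ∀ᵐ z ∂(ν : Measure ((G → I₀) × (∀ n, G → I n))),
          dist (z.2 p.2 g : ℝ) (z.1 g) ≤ 1 / ((p.1 : ℝ) + 1) := by
      intro p hp
      have hψ : Continuous fun z : (G → I₀) × (∀ n, G → I n) =>
          max (dist (z.2 p.2 g : ℝ) (z.1 g) - 1 / ((p.1 : ℝ) + 1)) 0 := by fun_prop
      -- Coordinate `g` of the `k`-shifted orbit point is the value at `g * k`, so a bound uniform
      -- on `G` holds along the whole orbit.
      filter_upwards [ae_eq_zero_of_tendsto_orbitAverage hν hψ (fun z => le_max_right _ _)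
        fun k => max_eq_right (sub_nonpos.2 ((dist_comm _ _).trans_le (hp (g * k)).le))] with z hz
      exact sub_nonpos.1 (max_eq_right_iff.1 hz)
    -- Only countably many pairs (tolerance, index) occur, so one null set serves for all of them.
    filter_upwards [ae_all_iff.2 fun p => eventually_imp_distrib_left.2 (key p)] with z hz
    rw [Metric.tendsto_atTop]
    intro ε hε
    obtain ⟨k, hk⟩ := exists_nat_one_div_lt hε
    obtain ⟨M, hM⟩ := eventually_atTop.1 (h (1 / ((k : ℝ) + 1)) Nat.one_div_pos_of_nat)
    exact ⟨M, fun n hn => (hz (k, n) (hM n hn)).trans_lt hk⟩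

end Limit

end Determinism

theorem mainTheorem8 {G : Type*} [Semigroup G] [IsCancelMul G] [Countable G] [Infinite G]
    (hG : Determinism.IsAmenable G) :
    (∀ F : ℕ → Finset G, Determinism.IsFolner F →
      ∀ (f : ℕ → G → ℝ) (f₀ : G → ℝ),
        (∀ n, Determinism.FDeterministic F (f n)) →
        TendstoUniformly f f₀ atTop →
        Determinism.FDeterministic F f₀) ∧
    ∃ A : Subalgebra ℝ (G → ℝ),
      (∀ f : G → ℝ, f ∈ A ↔ Determinism.StronglyDeterministic f) ∧
      ∀ (f : ℕ → G → ℝ) (f₀ : G → ℝ),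
        (∀ n, f n ∈ A) → TendstoUniformly f f₀ atTop → f₀ ∈ A := by
  refine ⟨fun F hF f f₀ hf h => Determinism.FDeterministic.of_tendstoUniformly hF hf h,
    Determinism.stronglyDeterministicSubalgebra G, fun f => Iff.rfl, fun f f₀ hf h => ?_⟩
  exact Determinism.StronglyDeterministic.of_tendstoUniformly hf h
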